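/- Let $d \ge 1$, let $X$ be a random vector in $\mathbb{R}^d$ whose law has a Lebesgue density $f$, and let $Y = \mu(X) + \epsilon$ with $\mu:\mathbb{R}^d\to\mathbb{R}$ measurable and $\epsilon$ independent of $X$, $\mathbb{E}\,\epsilon = 0$, $0 < \mathrm{Var}(\epsilon) < \infty$ and $\mathbb{E}\,Y^2 < \infty$. Assume that there are constants $0 < c \le C < \infty$ with $c \le f(X) \le C$ almost surely. Let $x \in \mathrm{supp}(X)$ (the topological support of the law of $X$) and assume that $f$ and $\mu$ are twice continuously differentiable with bounded second derivatives on an open neighbourhood of $x$ in $\mathbb{R}^d$. For $z_j = (x_j, y_j) \in \mathbb{R}^d\times\mathbb{R}$, $1\le j\le s$, let $\Phi(x; z_1,\dots,z_s) = y_{(1)}$ be the response attached to the feature vector $x_{(1)}$ that is closest to $x$ in Euclidean distance (ties being broken in favour of the smallest label). For a sample $Z_1,\dots,Z_n$ in $\mathbb{R}^d\times\mathbb{R}$ and $1 \le s \le n$ let $$D_n(s)(x) = \binom{n}{s}^{-1}\sum_{1\le i_1<\cdots<i_s\le n}\Phi(x; Z_{i_1},\dots,Z_{i_s}).$$ Then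 there is a function $B:\mathbb{N}\to\mathbb{R}$ such that for all $1\le s\le n$ and every sample $Z_1,\dots,Z_n$ of independent copies of $(X,Y)$, the random variable $D_n(s)(x)$ is integrable and $$\mathbb{E}\,D_n(s)(x) = \mu(x) + B(s),$$ and, as $s\to\infty$, $$B(s) = \Gamma(2/d+1)\,\frac{f(x)\,\mathrm{tr}(\mu''(x)) + 2\,\mu'(x)^{T} f'(x)}{2\,d\,V_d^{2/d}\,f(x)^{1+2/d}}\; s^{-2/d} + o(s^{-2/d}), \qquad V_d = \frac{\pi^{d/2}}{\Gamma(1+d/2)},$$ where $f'(x)$ and $\mu'(x)$ are the gradients of $f$ and $\mu$ at $x$, $\mu''(x)$ is the Hessian matrix of $\mu$ at $x$, $\mathrm{tr}$ is the trace and $\Gamma$ is the Gamma function. In particular the coefficient of $s^{-2/d}$ does not depend on $s$ or $n$, and the remainder is uniform in $n \ge s$. -/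

import Mathlib

open MeasureTheory ProbabilityTheory Filter Topology Asymptotics

noncomputable section

/-- `g` is twice continuously differentiable, with bounded second derivative, on some open
neighbourhood of `x` in `ℝ^d`. -/
def C2BoundedNear {d : ℕ} (g : EuclideanSpace ℝ (Fin d) → ℝ) (x : EuclideanSpace ℝ (Fin d)) :
    Prop :=
  ∃ U : Set (EuclideanSpace ℝ (Fin d)), IsOpen U ∧ x ∈ U ∧ ContDiffOn ℝ 2 g U ∧
    ∃ M : ℝ, ∀ y ∈ U, ‖iteratedFDeriv ℝ 2 g y‖ ≤ M

/-- The Hessian matrix of second partial derivatives of `g` at `x`. -/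
def hessianMatrix {d : ℕ} (g : EuclideanSpace ℝ (Fin d) → ℝ) (x : EuclideanSpace ℝ (Fin d)) :
    Matrix (Fin d) (Fin d) ℝ :=
  Matrix.of fun i j =>
    iteratedFDeriv ℝ 2 g x ![EuclideanSpace.single i (1 : ℝ), EuclideanSpace.single j (1 : ℝ)]

/-- The volume `V_d = π^{d/2} / Γ(1 + d/2)` of the Euclidean unit ball of `ℝ^d`. -/
def unitBallVol (d : ℕ) : ℝ :=
  Real.pi ^ ((d : ℝ) / 2) / Real.Gamma (1 + (d : ℝ) / 2)

/-- In the sample `z = ((X_1, Y_1), …, (X_s, Y_s))`, the `i`-th feature vector is the first nearest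
neighbour of `x` for the Euclidean distance; among features at equal distance, the one with the
smaller label comes first. -/
def IsFirstNN {d s : ℕ} (x : EuclideanSpace ℝ (Fin d))
    (z : Fin s → EuclideanSpace ℝ (Fin d) × ℝ) (i : Fin s) : Prop :=
  ∀ j : Fin s, ‖(z i).1 - x‖ ≤ ‖(z j).1 - x‖ ∧ (j < i → ‖(z i).1 - x‖ < ‖(z j).1 - x‖)

/-- A nonempty sample has exactly one first nearest neighbour of `x`. -/
theorem existsUnique_isFirstNN {d s : ℕ} (hs : 1 ≤ s) (x : EuclideanSpace ℝ (Fin d))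
    (z : Fin s → EuclideanSpace ℝ (Fin d) × ℝ) : ∃! i : Fin s, IsFirstNN x z i := by
  have hne : (Finset.univ : Finset (Fin s)).Nonempty := ⟨⟨0, hs⟩, Finset.mem_univ _⟩
  obtain ⟨i, -, hi⟩ := Finset.exists_min_image Finset.univ
    (fun i : Fin s => toLex (‖(z i).1 - x‖, i)) hne
  have key : IsFirstNN x z i := by
    intro j
    have h := hi j (Finset.mem_univ j)
    rw [Prod.Lex.toLex_le_toLex] at h
    rcases h with h | ⟨h1, h2⟩
    · exact ⟨le_of_lt h, fun _ => h⟩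
    · exact ⟨le_of_eq h1, fun hj => absurd h2 (not_le.mpr hj)⟩
  refine ⟨i, key, fun k hk => ?_⟩
  rcases lt_trichotomy k i with h | h | h
  · exact absurd ((key k).2 h) (not_lt.mpr (hk i).1)
  · exact h
  · exact absurd ((hk i).2 h) (not_lt.mpr (key k).1)

open Classical in
/-- The 1-nearest-neighbour estimator `Φ(x; Z_1, …, Z_s) = Y_{(1)}`: the response attached to the
unique first nearest neighbour of `x` in the sample (the sum below has exactly one term with a
true condition when `s ≥ 1`). -/
def oneNN {d s : ℕ} (x : EuclideanSpace ℝ (Fin d))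
    (z : Fin s → EuclideanSpace ℝ (Fin d) × ℝ) : ℝ :=
  ∑ i : Fin s, if IsFirstNN x z i then (z i).2 else 0

open Classical in
/-- The distributional nearest neighbours estimator `D_n(s)(x)`: the U-statistic
`(n choose s)⁻¹ ∑_{i_1 < ⋯ < i_s} Φ(x; Z_{i_1}, …, Z_{i_s})`. -/
def dnn {d n : ℕ} (s : ℕ) (x : EuclideanSpace ℝ (Fin d))
    (z : Fin n → EuclideanSpace ℝ (Fin d) × ℝ) : ℝ :=
  ((n.choose s : ℕ) : ℝ)⁻¹ *
    ∑ ι ∈ Finset.univ.filter (fun ι : Fin s → Fin n => StrictMono ι),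
      oneNN x (fun j => z (ι j))

/-- The coefficient of `s^{-2/d}` in the bias, computed from the density `f` and the regression
function `μ` at the point `x`:
`Γ(2/d+1) (f(x) tr μ''(x) + 2 μ'(x)ᵀ f'(x)) / (2 d V_d^{2/d} f(x)^{1+2/d})`. -/
def biasCoeff {d : ℕ} (f μ : EuclideanSpace ℝ (Fin d) → ℝ) (x : EuclideanSpace ℝ (Fin d)) : ℝ :=
  Real.Gamma (2 / (d : ℝ) + 1) *
    ((f x * (hessianMatrix μ x).trace + 2 * inner ℝ (gradient μ x) (gradient f x)) /
      (2 * (d : ℝ) * unitBallVol d ^ (2 / (d : ℝ)) * f x ^ (1 + 2 / (d : ℝ))))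

end

/-!
The bias of the one-nearest-neighbour estimator is a Laplace-type integral.

Every term of the U-statistic has the law of `oneNN` on `s` i.i.d. points, so the expectation of
`dnn` does not depend on `n` (`integrable_dnn_and_integral_dnn`). Write `ν` for the law of `X` and
`φ y = ν (closedBall x ‖y - x‖)`. A given sample point `p` is the nearest neighbour with conditional
probability `(1 - φ p.1) ^ (s - 1)`: as `ν` has a density, ties are null. Since the noise is centred
and independent of `X`, the bias is
`s ∫ (μ - μ x) (1 - φ) ^ (s - 1) ∂ν` (`integral_oneNN_sub_const`, `integral_response_sub_mul_comp`),
and the layer-cake formula `integral_mul_one_sub_pow_eq` turns it into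
`s (s - 1) ∫₀¹ (1 - v) ^ (s - 2) H v dv` with `H v = ∫ {φ ≤ v} (μ - μ x) ∂ν`.

The set `{φ ≤ v}` is a ball around `x` of `ν`-measure `v`
(`exists_setOf_measureReal_closedBall_le_eq`), so `H` can be read off from balls of small radius `r`:
their `ν`-measure is `f x V_d r ^ d + o(r ^ d)`, and the integral of `(μ - μ x) f` over them is
`(f x tr μ'' + 2 μ' ⬝ f') / 2 * V_d / (d + 2) * r ^ (d + 2) + o(r ^ (d + 2))` by Taylor expansion, as
odd terms integrate to zero and a quadratic form integrates to a multiple of its trace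
(`tendsto_setIntegral_closedBall_sub_mul_div`). Eliminating `r` gives `H v ~ K v ^ (1 + 2/d)`
(`tendsto_setIntegral_measureReal_closedBall_le_div`). Such a function has
`n ^ (2 + 2/d) ∫₀¹ (1 - v) ^ n H v dv → K Γ(2 + 2/d)` (`tendsto_rpow_mul_integral_one_sub_pow_mul`),
a consequence of Euler's limit formula for `Γ`, and this constant is `biasCoeff`.
-/

/-! ### A Watson lemma for the weights `(1 - v) ^ n` -/

/-- Euler's limit formula for `Γ`, in its Beta-integral form. -/
theorem tendsto_rpow_mul_integral_rpow_mul_one_sub_pow {q : ℝ} (hq : 0 < q) :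
    Tendsto (fun n : ℕ => (n : ℝ) ^ q * ∫ v in (0 : ℝ)..1, v ^ (q - 1) * (1 - v) ^ n) atTop
      (𝓝 (Real.Gamma q)) := by
  have h := Complex.GammaSeq_tendsto_Gamma (q : ℂ)
  rw [Complex.Gamma_ofReal] at h
  have h2 := (Complex.continuous_re.tendsto _).comp h
  rw [Complex.ofReal_re] at h2
  refine h2.congr fun n => ?_
  have hb : Complex.betaIntegral (q : ℂ) (n + 1) =
      ((∫ v in (0 : ℝ)..1, v ^ (q - 1) * (1 - v) ^ n : ℝ) : ℂ) := by
    rw [Complex.betaIntegral, ← intervalIntegral.integral_ofReal]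
    refine intervalIntegral.integral_congr_ae (ae_of_all _ fun v hv => ?_)
    rw [Set.uIoc_of_le zero_le_one] at hv
    rw [Complex.ofReal_mul, Complex.ofReal_cpow hv.1.le]
    simp
  rw [Function.comp_apply, Complex.GammaSeq_eq_betaIntegral_of_re_pos (by simpa using hq), hb,
    ← Complex.ofReal_natCast, ← Complex.ofReal_cpow (Nat.cast_nonneg n), ← Complex.ofReal_mul,
    Complex.ofReal_re]

theorem intervalIntegrable_rpow_mul_one_sub_pow {p : ℝ} (hp : 0 ≤ p) (n : ℕ) :
    IntervalIntegrable (fun v : ℝ => v ^ p * (1 - v) ^ n) volume 0 1 :=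
  ((Real.continuous_rpow_const hp).mul (by fun_prop)).intervalIntegrable _ _

/-- Only the behaviour `H v ~ K v ^ p` at `0⁺` of a bounded function matters for the limit of
`n ^ (p + 1) ∫₀¹ (1 - v) ^ n H v`. -/
theorem tendsto_rpow_mul_integral_one_sub_pow_mul {p K M : ℝ} (hp : 0 ≤ p) {H : ℝ → ℝ}
    (hint : IntervalIntegrable H volume 0 1) (hM : ∀ v ∈ Set.Ioo (0 : ℝ) 1, |H v| ≤ M)
    (hK : Tendsto (fun v => H v / v ^ p) (𝓝[>] 0) (𝓝 K)) :
    Tendsto (fun n : ℕ => (n : ℝ) ^ (p + 1) * ∫ v in (0 : ℝ)..1, (1 - v) ^ n * H v) atTop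
      (𝓝 (K * Real.Gamma (p + 1))) := by
  have hb := tendsto_rpow_mul_integral_rpow_mul_one_sub_pow (q := p + 1) (by linarith)
  have hb' := tendsto_rpow_mul_integral_rpow_mul_one_sub_pow (q := p + 2) (by linarith)
  rw [add_sub_cancel_right] at hb
  rw [show p + 2 - 1 = p + 1 by ring] at hb'
  -- one more power of `v` gains a factor `n⁻¹`
  have hc : Tendsto (fun n : ℕ => (n : ℝ) ^ (p + 1) * ∫ v in (0 : ℝ)..1, v ^ (p + 1) * (1 - v) ^ n)
      atTop (𝓝 0) := by
    have := (tendsto_natCast_atTop_atTop (R := ℝ)).inv_tendsto_atTop.mul hb'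
    rw [zero_mul] at this
    refine this.congr' ?_
    filter_upwards [eventually_gt_atTop 0] with n hn
    have hn' : (0 : ℝ) < n := by exact_mod_cast hn
    rw [show p + 2 = (p + 1) + 1 by ring, Real.rpow_add_one hn'.ne', Pi.inv_apply]
    field_simp
  have hM0 : 0 ≤ M := (abs_nonneg _).trans (hM (1 / 2) (by norm_num))
  suffices h : Tendsto (fun n : ℕ => (n : ℝ) ^ (p + 1) *
      ∫ v in (0 : ℝ)..1, (1 - v) ^ n * (H v - K * v ^ p)) atTop (𝓝 0) by
    have h2 := h.add (hb.const_mul K)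
    rw [zero_add] at h2
    refine h2.congr fun n => ?_
    have e1 : ∀ v : ℝ, (1 - v) ^ n * (H v - K * v ^ p) =
        (1 - v) ^ n * H v - K * (v ^ p * (1 - v) ^ n) := fun v => by ring
    simp_rw [e1]
    rw [intervalIntegral.integral_sub, intervalIntegral.integral_const_mul]
    · ring
    · exact hint.continuousOn_mul (by fun_prop)
    · exact (intervalIntegrable_rpow_mul_one_sub_pow hp n).const_mul K
  rw [Metric.tendsto_atTop']
  intro η hη
  set G := Real.Gamma (p + 1)
  have hG : 0 < G := Real.Gamma_pos_of_pos (by linarith)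
  obtain ⟨δ, hδ0, hδ⟩ : ∃ δ > 0, ∀ v ∈ Set.Ioo (0 : ℝ) δ, |H v / v ^ p - K| < η / (2 * G) := by
    have := (Metric.tendsto_nhdsWithin_nhds.1 hK) (η / (2 * G)) (by positivity)
    obtain ⟨δ, h0, h⟩ := this
    refine ⟨δ, h0, fun v hv => ?_⟩
    have := h (x := v) hv.1 (by rw [Real.dist_eq, sub_zero, abs_of_pos hv.1]; exact hv.2)
    rwa [Real.dist_eq] at this
  -- away from `0`, the constant `M + |K|` is at most `M' * v ^ (p + 1)`, whose
  -- integral against `(1 - v) ^ n` is of lower order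
  set M' := (M + |K|) / δ ^ (p + 1)
  have hbound : ∀ v ∈ Set.Ioo (0 : ℝ) 1,
      |H v - K * v ^ p| ≤ η / (2 * G) * v ^ p + M' * v ^ (p + 1) := by
    intro v hv
    have hvp : 0 < v ^ p := Real.rpow_pos_of_pos hv.1 p
    have hvp1 : 0 < v ^ (p + 1) := Real.rpow_pos_of_pos hv.1 _
    have hM'0 : 0 ≤ M' := by positivity
    rcases lt_or_ge v δ with h | h
    · have h1 := hδ v ⟨hv.1, h⟩
      have h2 : H v - K * v ^ p = (H v / v ^ p - K) * v ^ p := by field_simp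
      rw [h2, abs_mul, abs_of_pos hvp]
      nlinarith
    · have h1 : |H v - K * v ^ p| ≤ M + |K| := by
        refine (abs_sub _ _).trans (add_le_add (hM v hv) ?_)
        rw [abs_mul, abs_of_pos hvp]
        exact mul_le_of_le_one_right (abs_nonneg _) (Real.rpow_le_one hv.1.le hv.2.le hp)
      have h2 : M + |K| ≤ M' * v ^ (p + 1) := by
        rw [div_mul_eq_mul_div, le_div_iff₀ (by positivity)]
        gcongr
      have : 0 ≤ η / (2 * G) * v ^ p := by positivity
      linarith
  have hlim : Tendsto (fun n : ℕ => η / (2 * G) * ((n : ℝ) ^ (p + 1) *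
      ∫ v in (0 : ℝ)..1, v ^ p * (1 - v) ^ n) + M' * ((n : ℝ) ^ (p + 1) *
      ∫ v in (0 : ℝ)..1, v ^ (p + 1) * (1 - v) ^ n)) atTop (𝓝 (η / 2)) := by
    have := (hb.const_mul (η / (2 * G))).add (hc.const_mul M')
    rwa [mul_zero, add_zero, show η / (2 * G) * G = η / 2 by field_simp] at this
  obtain ⟨N, hN⟩ := eventually_atTop.1 (hlim.eventually_lt_const (half_lt_self hη))
  refine ⟨N, fun n hn => lt_of_le_of_lt ?_ (hN n hn.le)⟩
  rw [Real.dist_eq, sub_zero, abs_mul, abs_of_nonneg (by positivity : (0 : ℝ) ≤ (n : ℝ) ^ (p + 1))]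
  have e2 : ∀ a b : ℝ, η / (2 * G) * ((n : ℝ) ^ (p + 1) * a) + M' * ((n : ℝ) ^ (p + 1) * b) =
      (n : ℝ) ^ (p + 1) * (η / (2 * G) * a + M' * b) := fun a b => by ring
  rw [e2]
  refine mul_le_mul_of_nonneg_left ?_ (by positivity)
  have i1 := (intervalIntegrable_rpow_mul_one_sub_pow hp n).const_mul (η / (2 * G))
  have i2 := (intervalIntegrable_rpow_mul_one_sub_pow (p := p + 1) (by linarith) n).const_mul M'
  rw [← intervalIntegral.integral_const_mul, ← intervalIntegral.integral_const_mul,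
    ← intervalIntegral.integral_add i1 i2, ← Real.norm_eq_abs]
  refine intervalIntegral.norm_integral_le_of_norm_le zero_le_one ?_ (i1.add i2)
  -- the endpoint `1`, where no bound on `H` is assumed, is negligible
  filter_upwards [Measure.ae_ne volume (1 : ℝ)] with v hv1 hv
  have hv' : v ∈ Set.Ioo (0 : ℝ) 1 := ⟨hv.1, lt_of_le_of_ne hv.2 hv1⟩
  have h0 : 0 ≤ (1 - v) ^ n := pow_nonneg (by linarith [hv.2]) n
  rw [norm_mul, Real.norm_eq_abs, Real.norm_eq_abs, abs_of_nonneg h0]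
  calc (1 - v) ^ n * |H v - K * v ^ p|
      ≤ (1 - v) ^ n * (η / (2 * G) * v ^ p + M' * v ^ (p + 1)) :=
        mul_le_mul_of_nonneg_left (hbound v hv') h0
    _ = _ := by ring

/-! ### Second-order Taylor expansion in a normed space -/

/-- Second-order Taylor formula with Peano remainder: by symmetry of the second derivative, the
remainder has derivative `o(‖h‖)`, and the mean value inequality on the ball of radius `‖h‖`
concludes. -/
theorem ContDiffAt.taylor_two_isLittleO {E : Type*} [NormedAddCommGroup E] [NormedSpace ℝ E]
    {g : E → ℝ} {x : E} (hg : ContDiffAt ℝ 2 g x) :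
    (fun h : E => g (x + h) - g x - fderiv ℝ g x h - 1 / 2 * fderiv ℝ (fderiv ℝ g) x h h)
      =o[𝓝 0] (fun h : E => ‖h‖ ^ 2) := by
  have hsymm : ∀ v w, fderiv ℝ (fderiv ℝ g) x v w = fderiv ℝ (fderiv ℝ g) x w v :=
    hg.isSymmSndFDerivAt (by simp)
  have hd : ∀ᶠ y in 𝓝 x, DifferentiableAt ℝ g y := by
    filter_upwards [hg.eventually (by simp)] with y hy using hy.differentiableAt (by simp)
  have hd2 : HasFDerivAt (fderiv ℝ g) (fderiv ℝ (fderiv ℝ g) x) x :=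
    ((hg.fderiv_right (m := 1) (by norm_num)).differentiableAt (by simp)).hasFDerivAt
  set D := fderiv ℝ (fderiv ℝ g) x
  have hadd : Tendsto (fun h : E => x + h) (𝓝 0) (𝓝 x) := by
    have : Continuous (fun h : E => x + h) := by fun_prop
    simpa using this.tendsto 0
  rw [isLittleO_iff]
  intro c hc
  rw [hasFDerivAt_iff_isLittleO_nhds_zero, isLittleO_iff] at hd2
  obtain ⟨δ, hδ, hball⟩ := Metric.eventually_nhds_iff_ball.1 ((hadd.eventually hd).and (hd2 hc))
  filter_upwards [Metric.ball_mem_nhds (0 : E) hδ] with h hh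
  set R : E → ℝ := fun h => g (x + h) - g x - fderiv ℝ g x h - 1 / 2 * D h h
  have hR : ∀ k ∈ Metric.closedBall (0 : E) ‖h‖,
      HasFDerivWithinAt R (fderiv ℝ g (x + k) - fderiv ℝ g x - D k)
        (Metric.closedBall (0 : E) ‖h‖) k := by
    intro k hk
    have hk' : k ∈ Metric.ball (0 : E) δ := by
      rw [mem_ball_zero_iff] at hh ⊢
      rw [mem_closedBall_zero_iff] at hk
      exact hk.trans_lt hh
    have h1 : HasFDerivAt (fun k => g (x + k)) (fderiv ℝ g (x + k)) k :=
      
      (hasFDerivAt_comp_add_left x).2 (hball k hk').1.hasFDerivAt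
    have h2 : HasFDerivAt (fun k => D k k) (D k + D.flip k) k := by
      simpa using D.hasFDerivAt.clm_apply (hasFDerivAt_id k)
    have h3 := ((h1.sub_const (g x)).sub (fderiv ℝ g x).hasFDerivAt).sub (h2.const_mul (1 / 2))
    refine (h3.congr_fderiv ?_).hasFDerivWithinAt
    ext v
    simp only [sub_apply, smul_apply,
      add_apply, ContinuousLinearMap.flip_apply, smul_eq_mul, hsymm v k]
    ring
  have hbd : ∀ k ∈ Metric.closedBall (0 : E) ‖h‖,
      ‖fderiv ℝ g (x + k) - fderiv ℝ g x - D k‖ ≤ c * ‖h‖ := by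
    intro k hk
    have hk1 : ‖k‖ ≤ ‖h‖ := by simpa using hk
    have hk' : k ∈ Metric.ball (0 : E) δ := by
      rw [mem_ball_zero_iff] at hh ⊢
      exact hk1.trans_lt hh
    exact ((hball k hk').2).trans (by gcongr)
  have := (convex_closedBall (0 : E) ‖h‖).norm_image_sub_le_of_norm_hasFDerivWithin_le hR hbd
    (x := 0) (y := h) (by simp) (by simp)
  have hR0 : R 0 = 0 := by simp [R]
  rw [hR0, sub_zero, sub_zero] at this
  refine this.trans_eq ?_
  rw [norm_pow, norm_norm]
  ring

/-! ### Volume and second moments of Euclidean balls -/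

section Ball
variable {d : ℕ}

theorem unitBallVol_pos (d : ℕ) : 0 < unitBallVol d := by
  unfold unitBallVol
  have := Real.Gamma_pos_of_pos (s := 1 + (d : ℝ) / 2) (by positivity)
  positivity

theorem volume_real_closedBall (hd : 1 ≤ d) (x : EuclideanSpace ℝ (Fin d)) {r : ℝ} (hr : 0 ≤ r) :
    volume.real (Metric.closedBall x r) = unitBallVol d * r ^ d := by
  have : Nonempty (Fin d) := ⟨⟨0, hd⟩⟩
  have hV : √Real.pi ^ d / Real.Gamma ((d : ℝ) / 2 + 1) = unitBallVol d := by
    rw [unitBallVol, add_comm (1 : ℝ), Real.sqrt_eq_rpow, ← Real.rpow_mul_natCast Real.pi_pos.le]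
    ring_nf
  rw [Measure.real, EuclideanSpace.volume_closedBall, Fintype.card_fin, hV, ENNReal.toReal_mul,
    ENNReal.toReal_pow, ENNReal.toReal_ofReal hr, ENNReal.toReal_ofReal (unitBallVol_pos d).le,
    mul_comm]

theorem setIntegral_closedBall_comp_isometry
    (e : EuclideanSpace ℝ (Fin d) ≃ₗᵢ[ℝ] EuclideanSpace ℝ (Fin d))
    (F : EuclideanSpace ℝ (Fin d) → ℝ) (r : ℝ) :
    ∫ h in Metric.closedBall 0 r, F (e h) = ∫ h in Metric.closedBall 0 r, F h := by
  have := e.measurePreserving.setIntegral_preimage_emb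
    e.toMeasurableEquiv.measurableEmbedding F (Metric.closedBall 0 r)
  rwa [LinearIsometryEquiv.preimage_closedBall, map_zero] at this

theorem setIntegral_closedBall_clm (L : EuclideanSpace ℝ (Fin d) →L[ℝ] ℝ) (r : ℝ) :
    ∫ h in Metric.closedBall 0 r, L h = 0 := by
  have := setIntegral_closedBall_comp_isometry (LinearIsometryEquiv.neg ℝ) L r
  simp only [LinearIsometryEquiv.coe_neg, map_neg, integral_neg] at this
  linarith

theorem setIntegral_closedBall_norm_sq (hd : 1 ≤ d) {r : ℝ} (hr : 0 ≤ r) :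
    ∫ h in Metric.closedBall (0 : EuclideanSpace ℝ (Fin d)) r, ‖h‖ ^ 2 =
      d * (unitBallVol d * r ^ (d + 2) / (d + 2)) := by
  have : Nonempty (Fin d) := ⟨⟨0, hd⟩⟩
  have h := integral_fun_norm_addHaar (volume : Measure (EuclideanSpace ℝ (Fin d)))
    ((Set.Iic r).indicator fun t : ℝ => t ^ 2)
  have e1 : (fun h : EuclideanSpace ℝ (Fin d) => (Set.Iic r).indicator (fun t : ℝ => t ^ 2) ‖h‖) =
      (Metric.closedBall (0 : EuclideanSpace ℝ (Fin d)) r).indicator fun h => ‖h‖ ^ 2 := by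
    ext h
    by_cases hh : ‖h‖ ≤ r
    · rw [Set.indicator_of_mem (Set.mem_Iic.2 hh),
        Set.indicator_of_mem (mem_closedBall_zero_iff.2 hh)]
    · rw [Set.indicator_of_notMem (by simpa using hh),
        Set.indicator_of_notMem (by simpa using hh)]
  have e2 : (fun y : ℝ => y ^ (Module.finrank ℝ (EuclideanSpace ℝ (Fin d)) - 1) •
      (Set.Iic r).indicator (fun t : ℝ => t ^ 2) y) =
      (Set.Iic r).indicator fun t : ℝ => t ^ (d + 1) := by
    ext y
    obtain ⟨k, rfl⟩ := Nat.exists_eq_add_of_le hd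
    by_cases hy : y ∈ Set.Iic r
    · simp [hy]
      ring
    · simp [hy]
  rw [e1, e2, integral_indicator Metric.isClosed_closedBall.measurableSet,
    setIntegral_indicator measurableSet_Iic, Set.Ioi_inter_Iic,
    ← intervalIntegral.integral_of_le hr, integral_pow, finrank_euclideanSpace_fin,
    measureReal_def, ← Measure.addHaar_closedBall_eq_addHaar_ball, ← measureReal_def,
    volume_real_closedBall hd _ zero_le_one] at h
  rw [h]
  simp only [nsmul_eq_mul, smul_eq_mul, one_pow, Nat.cast_add, Nat.cast_one]
  rw [zero_pow (by omega)]
  ring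

theorem integrableOn_closedBall_of_continuous {F : EuclideanSpace ℝ (Fin d) → ℝ}
    (hF : Continuous F) (x : EuclideanSpace ℝ (Fin d)) (r : ℝ) :
    IntegrableOn F (Metric.closedBall x r) :=
  hF.continuousOn.integrableOn_compact (isCompact_closedBall x r)

/-- Off-diagonal moments vanish by a sign change of one coordinate; the diagonal ones agree by
swapping coordinates, and they add up to the integral of `‖h‖ ^ 2`. -/
theorem setIntegral_closedBall_coord_mul_coord (hd : 1 ≤ d) {r : ℝ} (hr : 0 ≤ r) (i j : Fin d) :
    ∫ h in Metric.closedBall (0 : EuclideanSpace ℝ (Fin d)) r, h i * h j =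
      if i = j then unitBallVol d * r ^ (d + 2) / (d + 2) else 0 := by
  split_ifs with hij
  · subst hij
    have hall : ∀ k, ∫ h in Metric.closedBall (0 : EuclideanSpace ℝ (Fin d)) r, h k * h k =
        ∫ h in Metric.closedBall (0 : EuclideanSpace ℝ (Fin d)) r, h i * h i := by
      intro k
      have := setIntegral_closedBall_comp_isometry
        (LinearIsometryEquiv.piLpCongrLeft 2 ℝ ℝ (Equiv.swap i k)) (fun h => h k * h k) r
      rw [← this]
      simp [LinearIsometryEquiv.piLpCongrLeft_apply]
    have hsum : ∑ k : Fin d, ∫ h in Metric.closedBall (0 : EuclideanSpace ℝ (Fin d)) r,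
        h k * h k = d * (unitBallVol d * r ^ (d + 2) / (d + 2)) := by
      rw [← integral_finsetSum _ fun k _ => integrableOn_closedBall_of_continuous (by fun_prop) 0 r,
        ← setIntegral_closedBall_norm_sq hd hr]
      refine integral_congr_ae (ae_of_all _ fun h => ?_)
      beta_reduce
      rw [EuclideanSpace.norm_sq_eq]
      simp only [Real.norm_eq_abs, pow_two, abs_mul_abs_self]
    simp_rw [hall] at hsum
    rw [Finset.sum_const, Finset.card_univ, Fintype.card_fin, nsmul_eq_mul] at hsum
    have hd0 : (d : ℝ) ≠ 0 := by positivity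
    exact mul_left_cancel₀ hd0 hsum
  · have := setIntegral_closedBall_comp_isometry
      (LinearIsometryEquiv.piLpCongrRight 2 fun k : Fin d =>
        if k = i then LinearIsometryEquiv.neg ℝ else LinearIsometryEquiv.refl ℝ ℝ)
      (fun h => h i * h j) r
    simp [Ne.symm hij, integral_neg] at this
    linarith

/-- The integral of a quadratic form over a centred ball is determined by its trace. -/
theorem setIntegral_closedBall_bilin (hd : 1 ≤ d) {r : ℝ} (hr : 0 ≤ r)
    (T : EuclideanSpace ℝ (Fin d) →L[ℝ] EuclideanSpace ℝ (Fin d) →L[ℝ] ℝ) :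
    ∫ h in Metric.closedBall (0 : EuclideanSpace ℝ (Fin d)) r, T h h =
      (∑ i, T (EuclideanSpace.single i 1) (EuclideanSpace.single i 1)) *
        (unitBallVol d * r ^ (d + 2) / (d + 2)) := by
  have hT : ∀ h : EuclideanSpace ℝ (Fin d), T h h = ∑ i, ∑ j,
      h i * h j * T (EuclideanSpace.single i 1) (EuclideanSpace.single j 1) := by
    intro h
    have hh : h = ∑ i, h i • EuclideanSpace.single i (1 : ℝ) := by
      ext k; simp [Finset.sum_apply, Pi.single_apply]
    conv_lhs => rw [hh]
    simp only [map_sum, map_smul, _root_.sum_apply, smul_apply, smul_eq_mul,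
      Finset.mul_sum, mul_assoc]
    rw [Finset.sum_comm]
    refine Finset.sum_congr rfl fun i _ => Finset.sum_congr rfl fun j _ => ?_
    ring
  simp_rw [hT]
  rw [integral_finsetSum _ fun k _ => integrableOn_closedBall_of_continuous (by fun_prop) 0 r,
    Finset.sum_mul]
  refine Finset.sum_congr rfl fun i _ => ?_
  rw [integral_finsetSum _ fun k _ => integrableOn_closedBall_of_continuous (by fun_prop) 0 r]
  simp_rw [integral_mul_const, setIntegral_closedBall_coord_mul_coord hd hr, ite_mul, zero_mul]
  rw [Finset.sum_ite_eq Finset.univ i]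
  simp [mul_comm]

end Ball

/-! ### Integrals over shrinking balls -/

section Expansion
variable {d : ℕ}

theorem setIntegral_closedBall_eq_setIntegral_zero (g : EuclideanSpace ℝ (Fin d) → ℝ)
    (x : EuclideanSpace ℝ (Fin d)) (r : ℝ) :
    ∫ y in Metric.closedBall x r, g y = ∫ h in Metric.closedBall 0 r, g (x + h) := by
  have := (measurePreserving_add_left volume x).setIntegral_preimage_emb
    (measurableEmbedding_addLeft x) g (Metric.closedBall x r)
  rw [← this]
  simp

/-- If `L + T` is the second-order Taylor polynomial of `g - g x` at `x`, then the integral of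
`g - g x` over a small ball is governed by the trace of `T`, as the linear part integrates to `0`. -/
theorem tendsto_setIntegral_closedBall_sub_div (hd : 1 ≤ d) {g : EuclideanSpace ℝ (Fin d) → ℝ}
    {x : EuclideanSpace ℝ (Fin d)} (hg : ContDiffAt ℝ 2 g x)
    {L : EuclideanSpace ℝ (Fin d) →L[ℝ] ℝ}
    {T : EuclideanSpace ℝ (Fin d) →L[ℝ] EuclideanSpace ℝ (Fin d) →L[ℝ] ℝ}
    (hT : (fun h => g (x + h) - g x - L h - T h h) =o[𝓝 0] (fun h => ‖h‖ ^ 2)) :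
    Tendsto (fun r => (∫ y in Metric.closedBall x r, g y - g x) / r ^ (d + 2))
      (𝓝[>] (0 : ℝ))
      (𝓝 ((∑ i, T (EuclideanSpace.single i 1) (EuclideanSpace.single i 1)) *
        (unitBallVol d / (d + 2)))) := by
  have hV := unitBallVol_pos d
  have hadd : Tendsto (fun h : EuclideanSpace ℝ (Fin d) => x + h) (𝓝 0) (𝓝 x) := by
    have : Continuous (fun h : EuclideanSpace ℝ (Fin d) => x + h) := by fun_prop
    simpa using this.tendsto 0
  have hcont : ∀ᶠ h in 𝓝 (0 : EuclideanSpace ℝ (Fin d)), ContinuousAt g (x + h) := by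
    refine hadd.eventually ?_
    filter_upwards [hg.eventually (by simp)] with y hy using hy.continuousAt
  rw [Metric.tendsto_nhds]
  intro η hη
  set c := η / (2 * unitBallVol d)
  have hc : 0 < c := by positivity
  obtain ⟨δ, hδ, hball⟩ := Metric.eventually_nhds_iff_ball.1
    (hcont.and (isLittleO_iff.1 hT hc))
  filter_upwards [Ioo_mem_nhdsGT hδ] with r hr
  have hr0 : 0 < r := hr.1
  have hsub : ∀ h ∈ Metric.closedBall (0 : EuclideanSpace ℝ (Fin d)) r, h ∈ Metric.ball 0 δ :=
    fun h hh => Metric.closedBall_subset_ball hr.2 hh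
  have hgi : IntegrableOn (fun h => g (x + h)) (Metric.closedBall 0 r) := by
    refine ContinuousOn.integrableOn_compact (isCompact_closedBall _ _) fun h hh => ?_
    exact ((hball h (hsub h hh)).1.comp (f := fun h => x + h) (by fun_prop)).continuousWithinAt
  have i0 : IntegrableOn (fun h => g (x + h) - g x) (Metric.closedBall 0 r) :=
    hgi.sub (integrableOn_closedBall_of_continuous (continuous_const (y := g x)) 0 r)
  have i1 := integrableOn_closedBall_of_continuous (F := L) (by fun_prop) 0 r
  have i01 : IntegrableOn (fun h => g (x + h) - g x - L h) (Metric.closedBall 0 r) := i0.sub i1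
  have i2 := integrableOn_closedBall_of_continuous (F := fun h => T h h) (by fun_prop) 0 r
  have key : ∫ h in Metric.closedBall 0 r, (g (x + h) - g x - L h - T h h) =
      (∫ y in Metric.closedBall x r, g y - g x) -
      (∑ i, T (EuclideanSpace.single i 1) (EuclideanSpace.single i 1)) *
        (unitBallVol d * r ^ (d + 2) / (d + 2)) := by
    rw [integral_sub i01 i2, integral_sub i0 i1, setIntegral_closedBall_clm,
      setIntegral_closedBall_bilin hd hr0.le, sub_zero,
      setIntegral_closedBall_eq_setIntegral_zero (fun y => g y - g x)]
  have hbd : ‖∫ h in Metric.closedBall 0 r, (g (x + h) - g x - L h - T h h)‖ ≤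
      c * r ^ 2 * volume.real (Metric.closedBall (0 : EuclideanSpace ℝ (Fin d)) r) := by
    refine norm_setIntegral_le_of_norm_le_const measure_closedBall_lt_top fun h hh => ?_
    refine ((hball h (hsub h hh)).2).trans ?_
    rw [norm_pow, norm_norm]
    have : ‖h‖ ≤ r := by simpa using hh
    gcongr
  rw [volume_real_closedBall hd _ hr0.le, key, Real.norm_eq_abs] at hbd
  have hrp : 0 < r ^ (d + 2) := by positivity
  rw [Real.dist_eq]
  have e : (∫ y in Metric.closedBall x r, g y - g x) / r ^ (d + 2) -
      (∑ i, T (EuclideanSpace.single i 1) (EuclideanSpace.single i 1)) *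
        (unitBallVol d / (d + 2)) = ((∫ y in Metric.closedBall x r, g y - g x) -
      (∑ i, T (EuclideanSpace.single i 1) (EuclideanSpace.single i 1)) *
        (unitBallVol d * r ^ (d + 2) / (d + 2))) / r ^ (d + 2) := by
    field_simp
  rw [e, abs_div, abs_of_pos hrp, div_lt_iff₀ hrp]
  refine hbd.trans_lt ?_
  have e2 : c * r ^ 2 * (unitBallVol d * r ^ d) = η / 2 * r ^ (d + 2) := by
    simp only [c]
    field_simp
    ring
  rw [e2]
  nlinarith

theorem tendsto_setIntegral_closedBall_div (hd : 1 ≤ d) {f : EuclideanSpace ℝ (Fin d) → ℝ}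
    {x : EuclideanSpace ℝ (Fin d)} (hf : ContDiffAt ℝ 2 f x) :
    Tendsto (fun r => (∫ y in Metric.closedBall x r, f y) / r ^ d) (𝓝[>] (0 : ℝ))
      (𝓝 (f x * unitBallVol d)) := by
  have hT := hf.taylor_two_isLittleO
  have h := tendsto_setIntegral_closedBall_sub_div hd hf (L := fderiv ℝ f x)
    (T := (1 / 2 : ℝ) • fderiv ℝ (fderiv ℝ f) x) (by simpa using hT)
  have hr2 : Tendsto (fun r : ℝ => r ^ 2) (𝓝[>] 0) (𝓝 0) := by
    have : Continuous (fun r : ℝ => r ^ 2) := by fun_prop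
    simpa using (this.tendsto 0).mono_left nhdsWithin_le_nhds
  have h2 := (h.mul hr2).add_const (f x * unitBallVol d)
  rw [mul_zero, zero_add] at h2
  refine h2.congr' ?_
  obtain ⟨δ, hδ, hball⟩ := Metric.eventually_nhds_iff_ball.1 (hf.eventually (by simp))
  filter_upwards [Ioo_mem_nhdsGT hδ] with r hr
  have hr0 : 0 < r := hr.1
  have hfi : IntegrableOn f (Metric.closedBall x r) := by
    refine ContinuousOn.integrableOn_compact (isCompact_closedBall _ _) fun h hh => ?_
    exact (hball h (Metric.closedBall_subset_ball hr.2 hh)).continuousAt.continuousWithinAt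
  rw [integral_sub hfi (integrableOn_closedBall_of_continuous continuous_const x r),
    setIntegral_const, volume_real_closedBall hd _ hr0.le, smul_eq_mul]
  field_simp
  ring

theorem trace_hessianMatrix (g : EuclideanSpace ℝ (Fin d) → ℝ) (x : EuclideanSpace ℝ (Fin d)) :
    (hessianMatrix g x).trace = ∑ i, fderiv ℝ (fderiv ℝ g) x (EuclideanSpace.single i 1)
      (EuclideanSpace.single i 1) := by
  simp [Matrix.trace, hessianMatrix, iteratedFDeriv_two_apply]

theorem inner_gradient_gradient {g f : EuclideanSpace ℝ (Fin d) → ℝ}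
    {x : EuclideanSpace ℝ (Fin d)} :
    inner ℝ (gradient g x) (gradient f x) = ∑ i, fderiv ℝ g x (EuclideanSpace.single i 1) *
      fderiv ℝ f x (EuclideanSpace.single i 1) := by
  have h : ∀ (g : EuclideanSpace ℝ (Fin d) → ℝ) (i : Fin d),
      fderiv ℝ g x (EuclideanSpace.single i 1) = gradient g x i := by
    intro g i
    rw [gradient, ← InnerProductSpace.toDual_symm_apply, EuclideanSpace.inner_single_right]
    simp
  simp_rw [h, PiLp.inner_apply]
  simp [mul_comm]

/-- The term `2 ⟪∇μ, ∇f⟫` comes from the product of the linear parts of `μ - μ x` and `f - f x`. -/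
theorem tendsto_setIntegral_closedBall_sub_mul_div (hd : 1 ≤ d)
    {f μ : EuclideanSpace ℝ (Fin d) → ℝ} {x : EuclideanSpace ℝ (Fin d)}
    (hf : ContDiffAt ℝ 2 f x) (hμ : ContDiffAt ℝ 2 μ x) :
    Tendsto (fun r => (∫ y in Metric.closedBall x r, (μ y - μ x) * f y) / r ^ (d + 2))
      (𝓝[>] (0 : ℝ))
      (𝓝 ((f x * (hessianMatrix μ x).trace + 2 * inner ℝ (gradient μ x) (gradient f x)) / 2 *
        (unitBallVol d / (d + 2)))) := by
  set D := fderiv ℝ (fderiv ℝ μ) x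
  have hadd : Tendsto (fun h : EuclideanSpace ℝ (Fin d) => x + h) (𝓝 0) (𝓝 x) := by
    have : Continuous (fun h : EuclideanSpace ℝ (Fin d) => x + h) := by fun_prop
    simpa using this.tendsto 0
  have hfc : Tendsto (fun h => f (x + h)) (𝓝 0) (𝓝 (f x)) := hf.continuousAt.tendsto.comp hadd
  have hf1 : (fun h => f (x + h) - f x - fderiv ℝ f x h) =o[𝓝 0] fun h => h :=
    hasFDerivAt_iff_isLittleO_nhds_zero.1 (hf.differentiableAt (by simp)).hasFDerivAt
  -- the error of the product of the two expansions is split into three terms of order `o(‖h‖ ^ 2)`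
  have t1 : (fun h => (μ (x + h) - μ x - fderiv ℝ μ x h - 1 / 2 * D h h) * f (x + h))
      =o[𝓝 0] (fun h => ‖h‖ ^ 2) := by
    simpa using hμ.taylor_two_isLittleO.mul_isBigO (hfc.isBigO_one ℝ)
  have t2 : (fun h => fderiv ℝ μ x h * (f (x + h) - f x - fderiv ℝ f x h))
      =o[𝓝 0] (fun h => ‖h‖ ^ 2) := by
    have := ((fderiv ℝ μ x).isBigO_id (𝓝 0)).norm_right.mul_isLittleO hf1.norm_right
    simpa only [← pow_two] using this
  have t3 : (fun h => 1 / 2 * D h h * (f (x + h) - f x)) =o[𝓝 0] (fun h => ‖h‖ ^ 2) := by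
    have hD : (fun h => 1 / 2 * D h h) =O[𝓝 0] (fun h => ‖h‖ ^ 2) := by
      refine IsBigO.const_mul_left (IsBigO.of_bound ‖D‖ (Eventually.of_forall fun h => ?_)) _
      rw [norm_pow, norm_norm, pow_two, ← mul_assoc]
      exact D.le_opNorm₂ h h
    have h0 : (fun h => f (x + h) - f x) =o[𝓝 0] (fun _ => (1 : ℝ)) := by
      rw [isLittleO_one_iff]
      simpa using hfc.sub_const (f x)
    simpa using hD.mul_isLittleO h0
  have := tendsto_setIntegral_closedBall_sub_div hd (g := fun y => (μ y - μ x) * f y)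
    ((hμ.sub contDiffAt_const).mul hf) (L := f x • fderiv ℝ μ x)
    (T := (f x / 2) • D + (fderiv ℝ μ x).smulRight (fderiv ℝ f x)) (x := x) (by
      refine ((t1.add t2).add t3).congr_left fun h => ?_
      simp
      ring)
  simp only [sub_self, zero_mul, sub_zero] at this
  convert this using 2
  rw [trace_hessianMatrix, inner_gradient_gradient]
  congr 1
  simp [Finset.sum_add_distrib, ← Finset.mul_sum]
  ring

end Expansion

/-! ### Distribution of the distance to the target point -/

section Radial
variable {E : Type*} [NormedAddCommGroup E] [MeasurableSpace E]
  {ν : Measure E} [IsProbabilityMeasure ν] {x : E}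

theorem monotone_measureReal_closedBall (ν : Measure E) [IsProbabilityMeasure ν] (x : E) :
    Monotone fun r => ν.real (Metric.closedBall x r) :=
  fun _ _ h => measureReal_mono (Metric.closedBall_subset_closedBall h)

theorem tendsto_measureReal_closedBall_atTop (ν : Measure E) [IsProbabilityMeasure ν] (x : E) :
    Tendsto (fun r => ν.real (Metric.closedBall x r)) atTop (𝓝 1) := by
  have h := tendsto_measure_iUnion_atTop (μ := ν) (s := fun r : ℝ => Metric.closedBall x r)
    (fun _ _ h => Metric.closedBall_subset_closedBall h)
  have hU : ⋃ r : ℝ, Metric.closedBall x r = Set.univ :=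
    Set.eq_univ_of_forall fun y => Set.mem_iUnion.2 ⟨dist y x, Metric.mem_closedBall.2 le_rfl⟩
  rw [hU, measure_univ] at h
  simpa [Measure.real, Function.comp_def] using
    (ENNReal.tendsto_toReal ENNReal.one_ne_top).comp h

variable [BorelSpace E]

/-- Since spheres are null, the distribution function of `‖y - x‖` is continuous. -/
theorem continuous_measureReal_closedBall (hν : ∀ r, ν (Metric.sphere x r) = 0) :
    Continuous fun r => ν.real (Metric.closedBall x r) := by
  have hrw : (fun r => ν.real (Metric.closedBall x r)) =
      fun r => ∫ y, (Metric.closedBall x r).indicator (fun _ => (1 : ℝ)) y ∂ν := by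
    ext r
    rw [integral_indicator_const _ Metric.isClosed_closedBall.measurableSet]
    simp
  rw [hrw, continuous_iff_continuousAt]
  intro r₀
  refine continuousAt_of_dominated (bound := fun _ => 1) (Eventually.of_forall fun r => ?_)
    (Eventually.of_forall fun r => ae_of_all _ fun y => ?_) (integrable_const _) ?_
  · exact (measurable_const.indicator
      Metric.isClosed_closedBall.measurableSet).aestronglyMeasurable
  · exact (norm_indicator_le_norm_self _ _).trans (by simp)
  · have h0 : ∀ᵐ y ∂ν, y ∉ Metric.sphere x r₀ := measure_eq_zero_iff_ae_notMem.1 (hν r₀)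
    filter_upwards [h0] with y hy
    have hne : dist y x ≠ r₀ := hy
    rcases lt_or_gt_of_ne hne with h | h
    · refine (continuousAt_const (y := (1 : ℝ))).congr ?_
      filter_upwards [lt_mem_nhds h] with r hr
      rw [Set.indicator_of_mem (Metric.mem_closedBall.2 (le_of_lt hr))]
    · refine (continuousAt_const (y := (0 : ℝ))).congr ?_
      filter_upwards [gt_mem_nhds h] with r hr
      rw [Set.indicator_of_notMem (by simpa using hr)]

/-- Every sublevel set of `y ↦ ν (closedBall x ‖y - x‖)` is itself a closed ball, of measure equal to
the level. -/
theorem exists_setOf_measureReal_closedBall_le_eq (hν : ∀ r, ν (Metric.sphere x r) = 0)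
    {v : ℝ} (hv0 : 0 < v) (hv1 : v < 1) :
    ∃ r, 0 < r ∧ ν.real (Metric.closedBall x r) = v ∧
      {y | ν.real (Metric.closedBall x ‖y - x‖) ≤ v} = Metric.closedBall x r := by
  set φ := fun r => ν.real (Metric.closedBall x r)
  have hmono : Monotone φ := monotone_measureReal_closedBall ν x
  have hcont : Continuous φ := continuous_measureReal_closedBall hν
  have hφ0 : φ 0 = 0 := by
    have := hν 0
    simp only [φ, Metric.closedBall_zero, Metric.sphere_zero] at this ⊢
    simp [Measure.real, this]
  set S := {r | φ r ≤ v}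
  have hS : IsClosed S := isClosed_le hcont continuous_const
  have h0S : (0 : ℝ) ∈ S := hφ0.le.trans hv0.le
  obtain ⟨R, hR⟩ := ((tendsto_measureReal_closedBall_atTop ν x).eventually_const_lt hv1).exists
  have hbdd : BddAbove S := ⟨R, fun r hr => by
    by_contra! h
    exact absurd (hmono h.le) (not_le.2 (lt_of_le_of_lt hr hR))⟩
  have hmem : sSup S ∈ S := hS.csSup_mem ⟨0, h0S⟩ hbdd
  -- points to the right of `sSup S` have `φ > v`, and `φ` is continuous
  have hge : v ≤ φ (sSup S) := by
    have hlim : Tendsto φ (𝓝[>] (sSup S)) (𝓝 (φ (sSup S))) :=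
      (hcont.tendsto _).mono_left nhdsWithin_le_nhds
    refine ge_of_tendsto hlim ?_
    filter_upwards [self_mem_nhdsWithin] with r hr
    by_contra! h
    exact absurd (le_csSup hbdd (show r ∈ S from h.le)) (not_le.2 hr)
  have heq : φ (sSup S) = v := le_antisymm hmem hge
  refine ⟨sSup S, ?_, heq, ?_⟩
  · refine lt_of_le_of_ne (le_csSup hbdd h0S) fun h => ?_
    rw [← h, hφ0] at heq
    exact hv0.ne heq
  · ext y
    rw [Metric.mem_closedBall, dist_eq_norm]
    exact ⟨fun h => le_csSup hbdd h, fun h => (hmono h).trans hmem⟩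

/-- Change of scale from the radius `r` to the probability `v` of the ball of radius `r`. -/
theorem tendsto_setIntegral_measureReal_closedBall_le_div {m : E → ℝ} {d : ℕ} (hd : 1 ≤ d)
    (hν : ∀ r, ν (Metric.sphere x r) = 0) {a b : ℝ} (ha : 0 < a)
    (hφ : Tendsto (fun r => ν.real (Metric.closedBall x r) / r ^ d) (𝓝[>] 0) (𝓝 a))
    (hm : Tendsto (fun r => (∫ y in Metric.closedBall x r, m y ∂ν) / r ^ (d + 2)) (𝓝[>] 0) (𝓝 b)) :
    Tendsto (fun v => (∫ y in {y | ν.real (Metric.closedBall x ‖y - x‖) ≤ v}, m y ∂ν) /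
      v ^ (1 + 2 / (d : ℝ))) (𝓝[>] 0) (𝓝 (b / a ^ (1 + 2 / (d : ℝ)))) := by
  have hd0 : (d : ℝ) ≠ 0 := by positivity
  have hmono := monotone_measureReal_closedBall ν x
  choose! ρ hρ0 hρ hρs using fun v (hv : v ∈ Set.Ioo (0 : ℝ) 1) =>
    exists_setOf_measureReal_closedBall_le_eq hν hv.1 hv.2
  have hIoo : Set.Ioo (0 : ℝ) 1 ∈ 𝓝[>] (0 : ℝ) := Ioo_mem_nhdsGT one_pos
  have hpos : ∀ δ > 0, 0 < ν.real (Metric.closedBall x δ) := by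
    intro δ hδ
    obtain ⟨r, hr, hr'⟩ := ((hφ.eventually_const_lt ha).and (Ioo_mem_nhdsGT hδ)).exists
    have : 0 < ν.real (Metric.closedBall x r) := by
      by_contra! h
      exact absurd hr (not_lt.2 (div_nonpos_of_nonpos_of_nonneg h (pow_nonneg hr'.1.le d)))
    exact this.trans_le (hmono hr'.2.le)
  have hρlim : Tendsto ρ (𝓝[>] 0) (𝓝[>] 0) := by
    rw [tendsto_nhdsWithin_iff]
    refine ⟨?_, by filter_upwards [hIoo] with v hv using hρ0 v hv⟩
    rw [Metric.tendsto_nhds]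
    intro δ hδ
    filter_upwards [hIoo, Ioo_mem_nhdsGT (hpos δ hδ)] with v hv hv'
    rw [Real.dist_eq, sub_zero, abs_of_pos (hρ0 v hv)]
    by_contra! h
    have := hmono h
    simp only [hρ v hv] at this
    exact absurd this (not_le.2 hv'.2)
  have hp : Tendsto (fun t : ℝ => t ^ (1 + 2 / (d : ℝ))) (𝓝 a) (𝓝 (a ^ (1 + 2 / (d : ℝ)))) :=
    (Real.continuousAt_rpow_const a _ (Or.inl ha.ne'))
  have hlim := (hm.div (hp.comp hφ) (Real.rpow_pos_of_pos ha _).ne').comp hρlim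
  refine hlim.congr' ?_
  filter_upwards [hIoo] with v hv
  have hr := hρ0 v hv
  have hrp : ((ρ v) ^ d) ^ (1 + 2 / (d : ℝ)) = (ρ v) ^ (d + 2) := by
    rw [← Real.rpow_natCast, ← Real.rpow_mul hr.le, ← Real.rpow_natCast]
    congr 1
    push_cast
    field_simp
  simp only [Function.comp_apply, Pi.div_apply]
  rw [hρs v hv, hρ v hv, Real.div_rpow hv.1.le (by positivity), hrp]
  have h1 : 0 < v ^ (1 + 2 / (d : ℝ)) := Real.rpow_pos_of_pos hv.1 _
  have h2 : 0 < ρ v ^ (d + 2) := by positivity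
  field_simp

end Radial

section LayerCake
variable {α : Type*} [MeasurableSpace α] {ν : Measure α}

/-- The integrability that Fubini's theorem requires in `integral_mul_one_sub_pow_eq`. -/
theorem integrable_prod_indicator {m : α → ℝ} (hm : Integrable m ν) {φ : α → ℝ}
    (hφ : Measurable φ) (n : ℕ) :
    Integrable (fun p : α × ℝ => {q : α × ℝ | φ q.1 ≤ q.2}.indicator
      (fun q => m q.1 * (1 - q.2) ^ n) p) (ν.prod (volume.restrict (Set.Ioc (0 : ℝ) 1))) := by
  refine Integrable.indicator ?_ (measurableSet_le (by fun_prop) measurable_snd)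
  refine hm.mul_prod (f := m) (g := fun v : ℝ => (1 - v) ^ n) ?_
  exact (Continuous.integrableOn_Icc (by fun_prop)).mono_set Set.Ioc_subset_Icc_self

variable [SFinite ν]

/-- Layer-cake formula, from `(1 - u) ^ (n + 1) = (n + 1) ∫ᵤ¹ (1 - v) ^ n dv` and Fubini. -/
theorem integral_mul_one_sub_pow_eq {m : α → ℝ} (hm : Integrable m ν) {φ : α → ℝ}
    (hφ : Measurable φ) (hφ0 : ∀ y, 0 ≤ φ y) (hφ1 : ∀ y, φ y ≤ 1) (n : ℕ) :
    ∫ y, m y * (1 - φ y) ^ (n + 1) ∂ν =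
      (n + 1) * ∫ v in (0 : ℝ)..1, (1 - v) ^ n * ∫ y in {y | φ y ≤ v}, m y ∂ν := by
  have hinner : ∀ y, m y * (1 - φ y) ^ (n + 1) = (n + 1) * ∫ v in Set.Ioc (0 : ℝ) 1,
      {q : α × ℝ | φ q.1 ≤ q.2}.indicator (fun q => m q.1 * (1 - q.2) ^ n) (y, v) := by
    intro y
    have h1 : (fun v : ℝ => {q : α × ℝ | φ q.1 ≤ q.2}.indicator
        (fun q => m q.1 * (1 - q.2) ^ n) (y, v)) =
        (Set.Ici (φ y)).indicator fun v => m y * (1 - v) ^ n := by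
      ext v
      simp [Set.indicator_apply]
    have h2 : (Set.Ioc (0 : ℝ) 1 ∩ Set.Ici (φ y) : Set ℝ) =ᵐ[volume] Set.Ioc (φ y) 1 := by
      have h3 : (Set.Ioc (0 : ℝ) 1 ∩ Set.Ioi (φ y) : Set ℝ) = Set.Ioc (φ y) 1 := by
        ext v
        simp only [Set.mem_inter_iff, Set.mem_Ioc, Set.mem_Ioi]
        have := hφ0 y
        constructor
        · rintro ⟨⟨_, h⟩, h'⟩; exact ⟨h', h⟩
        · rintro ⟨h, h'⟩; exact ⟨⟨by linarith, h'⟩, h⟩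
      rw [← h3]
      exact (ae_eq_refl _).inter Ioi_ae_eq_Ici.symm
    rw [h1, setIntegral_indicator measurableSet_Ici, setIntegral_congr_set h2,
      ← intervalIntegral.integral_of_le (hφ1 y), intervalIntegral.integral_const_mul,
      intervalIntegral.integral_comp_sub_left (fun v => v ^ n) 1, integral_pow]
    simp only [sub_self]
    rw [zero_pow (by omega)]
    field_simp
    ring
  simp_rw [hinner]
  rw [integral_const_mul, integral_integral_swap (integrable_prod_indicator hm hφ n),
    intervalIntegral.integral_of_le zero_le_one]
  congr 1
  refine integral_congr_ae (ae_of_all _ fun v => ?_)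
  beta_reduce
  rw [← integral_const_mul, ← integral_indicator (measurableSet_le hφ measurable_const)]
  refine integral_congr_ae (ae_of_all _ fun y => ?_)
  by_cases h : φ y ≤ v <;> simp [h, mul_comm]

theorem intervalIntegrable_setIntegral_le {m : α → ℝ} (hm : Integrable m ν) {φ : α → ℝ}
    (hφ : Measurable φ) :
    IntervalIntegrable (fun v => ∫ y in {y | φ y ≤ v}, m y ∂ν) volume 0 1 := by
  rw [intervalIntegrable_iff_integrableOn_Ioc_of_le zero_le_one]
  refine (integrable_prod_indicator hm hφ 0).integral_prod_right.congr (ae_of_all _ fun v => ?_)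
  beta_reduce
  rw [← integral_indicator (measurableSet_le hφ measurable_const)]
  refine integral_congr_ae (ae_of_all _ fun y => ?_)
  by_cases h : φ y ≤ v <;> simp [h]

end LayerCake

/-! ### The nearest neighbour of an i.i.d. sample -/

section NearestNeighbour
variable {d : ℕ}

theorem measurableSet_isFirstNN {s : ℕ} (x : EuclideanSpace ℝ (Fin d)) (i : Fin s) :
    MeasurableSet {z : Fin s → EuclideanSpace ℝ (Fin d) × ℝ | IsFirstNN x z i} := by
  have hm : ∀ j : Fin s, Measurable fun z : Fin s → EuclideanSpace ℝ (Fin d) × ℝ => ‖(z j).1 - x‖ :=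
    fun j => by fun_prop
  have : {z : Fin s → EuclideanSpace ℝ (Fin d) × ℝ | IsFirstNN x z i} =
      ⋂ j, ({z | ‖(z i).1 - x‖ ≤ ‖(z j).1 - x‖} ∩
        {z | j < i → ‖(z i).1 - x‖ < ‖(z j).1 - x‖}) := by
    ext z
    simp [IsFirstNN]
  rw [this]
  refine MeasurableSet.iInter fun j => (measurableSet_le (hm i) (hm j)).inter ?_
  by_cases h : j < i
  · simpa [h] using measurableSet_lt (hm i) (hm j)
  · simp [h]

/-- Once the `i`-th point is fixed, being the first nearest neighbour is a condition on each other
point separately: strict for smaller labels, weak for larger ones. -/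
theorem isFirstNN_insertNth_iff {k : ℕ} (x : EuclideanSpace ℝ (Fin d)) (i : Fin (k + 1))
    (p : EuclideanSpace ℝ (Fin d) × ℝ) (w : Fin k → EuclideanSpace ℝ (Fin d) × ℝ) :
    IsFirstNN x (i.insertNth (α := fun _ => EuclideanSpace ℝ (Fin d) × ℝ) p w) i ↔
      ∀ j, w j ∈ if i.succAbove j < i then {q | ‖p.1 - x‖ < ‖q.1 - x‖}
        else {q | ‖p.1 - x‖ ≤ ‖q.1 - x‖} := by
  rw [IsFirstNN, Fin.forall_iff_succAbove i]
  simp only [Fin.insertNth_apply_same, Fin.insertNth_apply_succAbove, le_refl, lt_irrefl,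
    false_imp_iff, and_self, true_and]
  refine forall_congr' fun j => ?_
  split_ifs with h
  · exact ⟨fun h' => h'.2 h, fun h' => ⟨le_of_lt h', fun _ => h'⟩⟩
  · exact ⟨fun h' => h'.1, fun h' => ⟨h', fun h'' => absurd h'' h⟩⟩

variable {ρ : Measure (EuclideanSpace ℝ (Fin d) × ℝ)} [IsProbabilityMeasure ρ]
  {x : EuclideanSpace ℝ (Fin d)}

open Classical in
theorem integrable_ite_isFirstNN {s : ℕ} {ψ : EuclideanSpace ℝ (Fin d) × ℝ → ℝ}
    (hψ : Integrable ψ ρ) (i : Fin s) :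
    Integrable (fun z => if IsFirstNN x z i then ψ (z i) else 0) (Measure.pi fun _ => ρ) := by
  have h : Integrable (fun z : Fin s → EuclideanSpace ℝ (Fin d) × ℝ => ψ (z i))
      (Measure.pi fun _ => ρ) :=
    (measurePreserving_eval (fun _ : Fin s => ρ) i).integrable_comp_of_integrable hψ
  refine (h.indicator (measurableSet_isFirstNN x i)).congr (ae_of_all _ fun z => ?_)
  simp [Set.indicator_apply]

theorem measureReal_norm_sub_lt {ν : Measure (EuclideanSpace ℝ (Fin d))} [IsProbabilityMeasure ν]
    (r : ℝ) : ν.real {y | r < ‖y - x‖} = 1 - ν.real (Metric.closedBall x r) := by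
  rw [← probReal_compl_eq_one_sub Metric.isClosed_closedBall.measurableSet]
  congr 1
  ext y
  simp [dist_eq_norm]

theorem measureReal_le_norm_sub {ν : Measure (EuclideanSpace ℝ (Fin d))} [IsProbabilityMeasure ν]
    {r : ℝ} (hν : ν (Metric.sphere x r) = 0) :
    ν.real {y | r ≤ ‖y - x‖} = 1 - ν.real (Metric.closedBall x r) := by
  rw [← measureReal_norm_sub_lt]
  refine measureReal_congr ?_
  filter_upwards [measure_eq_zero_iff_ae_notMem.1 hν] with y hy
  have hne : ‖y - x‖ ≠ r := fun h => hy (by rw [Metric.mem_sphere, dist_eq_norm, h])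
  exact propext ⟨fun h => lt_of_le_of_ne h hne.symm, fun h => le_of_lt h⟩

open Classical in
/-- Given `z i = p`, the `k` other points are independent, and each is farther from `x` than `p` with
probability `1 - ν (closedBall x ‖p.1 - x‖)`. Ties do not matter because spheres are null. -/
theorem integral_ite_isFirstNN {k : ℕ} {ψ : EuclideanSpace ℝ (Fin d) × ℝ → ℝ}
    (hψ : Integrable ψ ρ) (hρ : ∀ r, ρ.map Prod.fst (Metric.sphere x r) = 0) (i : Fin (k + 1)) :
    ∫ z, (if IsFirstNN x z i then ψ (z i) else 0) ∂(Measure.pi fun _ => ρ) =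
      ∫ p, ψ p * (1 - (ρ.map Prod.fst).real (Metric.closedBall x ‖p.1 - x‖)) ^ k ∂ρ := by
  have : IsProbabilityMeasure (ρ.map Prod.fst) :=
    Measure.isProbabilityMeasure_map measurable_fst.aemeasurable
  have hmp := (measurePreserving_piFinSuccAbove (fun _ : Fin (k + 1) => ρ) i).symm
  rw [← hmp.integral_comp']
  have hint := hmp.integrable_comp_of_integrable (integrable_ite_isFirstNN (x := x) hψ i)
  refine (integral_prod _ hint).trans (integral_congr_ae (ae_of_all _ fun p => ?_))
  have hS : ∀ j : Fin k, ρ.real (if i.succAbove j < i then {q | ‖p.1 - x‖ < ‖q.1 - x‖}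
      else {q | ‖p.1 - x‖ ≤ ‖q.1 - x‖}) =
      1 - (ρ.map Prod.fst).real (Metric.closedBall x ‖p.1 - x‖) := by
    intro j
    split_ifs
    · rw [← measureReal_norm_sub_lt, map_measureReal_apply measurable_fst
        (measurableSet_lt (by fun_prop) (by fun_prop))]
      rfl
    · rw [← measureReal_le_norm_sub (hρ _), map_measureReal_apply measurable_fst
        (measurableSet_le (by fun_prop) (by fun_prop))]
      rfl
  have hSm : ∀ j : Fin k, MeasurableSet (if i.succAbove j < i then
      {q : EuclideanSpace ℝ (Fin d) × ℝ | ‖p.1 - x‖ < ‖q.1 - x‖}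
      else {q | ‖p.1 - x‖ ≤ ‖q.1 - x‖}) := by
    intro j
    split_ifs
    · exact measurableSet_lt (by fun_prop) (by fun_prop)
    · exact measurableSet_le (by fun_prop) (by fun_prop)
  have hfun : ∀ w : Fin k → EuclideanSpace ℝ (Fin d) × ℝ,
      (if IsFirstNN x (i.insertNth (α := fun _ => EuclideanSpace ℝ (Fin d) × ℝ) p w) i
        then ψ (i.insertNth (α := fun _ => EuclideanSpace ℝ (Fin d) × ℝ) p w i) else 0) =
      (Set.univ.pi fun j : Fin k => if i.succAbove j < i then {q | ‖p.1 - x‖ < ‖q.1 - x‖}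
        else {q | ‖p.1 - x‖ ≤ ‖q.1 - x‖}).indicator (fun _ => ψ p) w := by
    intro w
    rw [Fin.insertNth_apply_same, Set.indicator_apply]
    simp only [isFirstNN_insertNth_iff, Set.mem_univ_pi]
  change ∫ w, (if IsFirstNN x (i.insertNth (α := fun _ => EuclideanSpace ℝ (Fin d) × ℝ) p w) i
    then ψ (i.insertNth (α := fun _ => EuclideanSpace ℝ (Fin d) × ℝ) p w i) else 0)
    ∂(Measure.pi fun _ : Fin k => ρ) = _
  simp_rw [hfun]
  rw [integral_indicator_const _ (MeasurableSet.univ_pi hSm), smul_eq_mul, mul_comm,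
    Measure.real, Measure.pi_pi, ENNReal.toReal_prod]
  simp_rw [← measureReal_def, hS]
  simp

open Classical in
/-- Exactly one label is the first nearest neighbour, so constants move inside the sum. -/
theorem oneNN_sub_const {s : ℕ} (hs : 1 ≤ s) (x : EuclideanSpace ℝ (Fin d)) (c : ℝ)
    (z : Fin s → EuclideanSpace ℝ (Fin d) × ℝ) :
    oneNN x z - c = ∑ i : Fin s, if IsFirstNN x z i then (z i).2 - c else 0 := by
  obtain ⟨i, hi, hu⟩ := existsUnique_isFirstNN hs x z
  have h : ∀ j, IsFirstNN x z j ↔ j = i := fun j => ⟨hu j, fun h => h ▸ hi⟩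
  simp [oneNN, h]

theorem integrable_oneNN {s : ℕ} (hρ2 : Integrable Prod.snd ρ) :
    Integrable (oneNN x) (Measure.pi fun _ : Fin s => ρ) := by
  classical
  exact integrable_finsetSum _ fun i _ => integrable_ite_isFirstNN hρ2 i

/-- By exchangeability each of the `k + 1` labels contributes the same amount. -/
theorem integral_oneNN_sub_const {k : ℕ} (hρ2 : Integrable Prod.snd ρ)
    (hρ : ∀ r, ρ.map Prod.fst (Metric.sphere x r) = 0) (c : ℝ) :
    ∫ z, oneNN x z ∂(Measure.pi fun _ : Fin (k + 1) => ρ) - c =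
      (k + 1) * ∫ p, (p.2 - c) *
        (1 - (ρ.map Prod.fst).real (Metric.closedBall x ‖p.1 - x‖)) ^ k ∂ρ := by
  classical
  have hψ : Integrable (fun p : EuclideanSpace ℝ (Fin d) × ℝ => p.2 - c) ρ :=
    hρ2.sub (integrable_const c)
  have h1 : ∫ z, oneNN x z ∂(Measure.pi fun _ : Fin (k + 1) => ρ) - c =
      ∫ z, (oneNN x z - c) ∂(Measure.pi fun _ : Fin (k + 1) => ρ) := by
    rw [integral_sub (integrable_oneNN hρ2) (integrable_const c)]
    simp
  rw [h1]
  simp_rw [oneNN_sub_const (Nat.le_add_left 1 k)]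
  rw [integral_finsetSum _ fun i _ => integrable_ite_isFirstNN hψ i]
  simp_rw [integral_ite_isFirstNN hψ hρ]
  simp

theorem card_filter_strictMono (s n : ℕ) :
    Nat.card {ι : Fin s → Fin n // StrictMono ι} = n.choose s := by
  have e : {ι : Fin s → Fin n // StrictMono ι} ≃ (Fin s ↪o Fin n) :=
    { toFun := fun ι => OrderEmbedding.ofStrictMono ι.1 ι.2
      invFun := fun f => ⟨f, f.strictMono⟩
      left_inv := fun _ => rfl
      right_inv := fun _ => rfl }
  rw [Nat.card_congr (e.trans Set.powersetCard.ofFinEmbEquiv), Set.powersetCard.card]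
  simp

/-- The U-statistic averages `n.choose s` terms, each with the law of `oneNN` on `s` points, hence its
expectation does not depend on `n`. -/
theorem integrable_dnn_and_integral_dnn {s n : ℕ} (hsn : s ≤ n) (hρ2 : Integrable Prod.snd ρ)
    {Ω : Type*} [MeasurableSpace Ω] {P : Measure Ω} [IsProbabilityMeasure P]
    {Z : Fin n → Ω → EuclideanSpace ℝ (Fin d) × ℝ} (hZ : iIndepFun Z P)
    (hZm : ∀ i, AEMeasurable (Z i) P) (hZρ : ∀ i, P.map (Z i) = ρ) :
    Integrable (fun ω => dnn s x fun i => Z i ω) P ∧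
      ∫ ω, dnn s x (fun i => Z i ω) ∂P = ∫ z, oneNN x z ∂(Measure.pi fun _ : Fin s => ρ) := by
  classical
  have hmap : ∀ ι : Fin s → Fin n, StrictMono ι →
      P.map (fun ω j => Z (ι j) ω) = Measure.pi fun _ : Fin s => ρ := by
    intro ι hι
    rw [(hZ.precomp hι.injective).map_fun_eq_pi_map fun j => hZm (ι j)]
    simp_rw [hZρ]
  have hae : ∀ ι : Fin s → Fin n, AEMeasurable (fun ω j => Z (ι j) ω) P :=
    fun ι => aemeasurable_pi_lambda _ fun j => hZm (ι j)
  have hone : Integrable (oneNN x) (Measure.pi fun _ : Fin s => ρ) := integrable_oneNN hρ2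
  have hint : ∀ ι ∈ Finset.univ.filter (fun ι : Fin s → Fin n => StrictMono ι),
      Integrable (fun ω => oneNN x fun j => Z (ι j) ω) P := by
    intro ι hι
    rw [← hmap ι (by simpa using hι)] at hone
    exact hone.comp_aemeasurable (hae ι)
  refine ⟨(integrable_finsetSum _ hint).const_mul _, ?_⟩
  have hval : ∀ ι ∈ Finset.univ.filter (fun ι : Fin s → Fin n => StrictMono ι),
      ∫ ω, oneNN x (fun j => Z (ι j) ω) ∂P = ∫ z, oneNN x z ∂(Measure.pi fun _ : Fin s => ρ) := by
    intro ι hι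
    rw [← hmap ι (by simpa using hι)] at hone ⊢
    exact (integral_map (hae ι) hone.aestronglyMeasurable).symm
  have hcard : (Finset.univ.filter (fun ι : Fin s → Fin n => StrictMono ι)).card = n.choose s := by
    rw [← card_filter_strictMono, Nat.card_eq_fintype_card, Fintype.card_subtype]
  simp only [dnn]
  rw [integral_const_mul, integral_finsetSum _ hint, Finset.sum_congr rfl hval, Finset.sum_const,
    hcard, nsmul_eq_mul, inv_mul_cancel_left₀]
  exact_mod_cast (Nat.choose_pos hsn).ne'

end NearestNeighbour

/-! ### The bias of the estimator -/

section Bias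
variable {d : ℕ}

theorem C2BoundedNear.contDiffAt {g : EuclideanSpace ℝ (Fin d) → ℝ} {x : EuclideanSpace ℝ (Fin d)}
    (h : C2BoundedNear g x) : ContDiffAt ℝ 2 g x := by
  obtain ⟨U, hU, hx, hg, -⟩ := h
  exact hg.contDiffAt (hU.mem_nhds hx)

/-- A lower bound that holds only almost surely for the law passes to the points of its support where
`f` is continuous. -/
theorem pos_of_mem_support {ν : Measure (EuclideanSpace ℝ (Fin d))}
    {f : EuclideanSpace ℝ (Fin d) → ℝ} {x : EuclideanSpace ℝ (Fin d)} (hx : x ∈ ν.support)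
    (hf : ContinuousAt f x) {c : ℝ} (hc : 0 < c) (hcf : ∀ᵐ y ∂ν, c ≤ f y) : 0 < f x := by
  by_contra! h
  have hnhds : {y | f y < c} ∈ 𝓝 x := hf.eventually_lt_const (h.trans_lt hc)
  have hpos := (Measure.mem_support_iff_forall x).1 hx _ hnhds
  refine hpos.ne' (measure_mono_null (fun y hy => ?_) hcf)
  exact fun h' : c ≤ f y => absurd h' (not_le.2 hy)

theorem setIntegral_withDensity_ofReal {f : EuclideanSpace ℝ (Fin d) → ℝ} (hf : Measurable f)
    (hf0 : ∀ y, 0 ≤ f y) (m : EuclideanSpace ℝ (Fin d) → ℝ) {S : Set (EuclideanSpace ℝ (Fin d))}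
    (hS : MeasurableSet S) :
    ∫ y in S, m y ∂(volume.withDensity fun y => ENNReal.ofReal (f y)) =
      ∫ y in S, m y * f y := by
  rw [setIntegral_withDensity_eq_setIntegral_toReal_smul hf.ennreal_ofReal
    (ae_of_all _ fun _ => ENNReal.ofReal_lt_top) _ hS]
  simp [ENNReal.toReal_ofReal (hf0 _), mul_comm]

/-- With `a = f x V_d` and `b` the limit of the integrals of `(μ - μ x) f` over balls divided by
`r ^ (d + 2)`, the constant of the Watson lemma `b / a ^ (1 + 2/d) Γ(2 + 2/d)` is `biasCoeff`. -/
theorem gamma_mul_eq_biasCoeff (hd : 1 ≤ d) {f μ : EuclideanSpace ℝ (Fin d) → ℝ}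
    {x : EuclideanSpace ℝ (Fin d)} (hfx : 0 < f x) :
    (f x * (hessianMatrix μ x).trace + 2 * inner ℝ (gradient μ x) (gradient f x)) / 2 *
      (unitBallVol d / (d + 2)) / (f x * unitBallVol d) ^ (1 + 2 / (d : ℝ)) *
      Real.Gamma (1 + 2 / (d : ℝ) + 1) = biasCoeff f μ x := by
  have hd0 : (0 : ℝ) < d := by exact_mod_cast hd
  have hV := unitBallVol_pos d
  rw [Real.Gamma_add_one (by positivity), Real.mul_rpow hfx.le hV.le,
    Real.rpow_add hV 1 (2 / (d : ℝ)), Real.rpow_one, biasCoeff, add_comm (2 / (d : ℝ)) 1]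
  have h1 : 0 < f x ^ (1 + 2 / (d : ℝ)) := Real.rpow_pos_of_pos hfx _
  have h2 : 0 < unitBallVol d ^ (2 / (d : ℝ)) := Real.rpow_pos_of_pos hV _
  field_simp

/-- Replaces the normalization `n ^ (2 + p)` by `s ^ p` for `s = n + 2`, the factor
`s (s - 1) = (n + 2) (n + 1)` being part of `B`. -/
theorem isLittleO_of_tendsto_rpow_mul {p K : ℝ} {J B : ℕ → ℝ}
    (hJ : Tendsto (fun n : ℕ => (n : ℝ) ^ (1 + p + 1) * J n) atTop (𝓝 K))
    (hB : ∀ n, B (n + 2) = (n + 2) * ((n + 1) * J n)) :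
    (fun s : ℕ => B s - K * (s : ℝ) ^ (-p)) =o[atTop] (fun s : ℕ => (s : ℝ) ^ (-p)) := by
  have h1 : Tendsto (fun n : ℕ => ((n : ℝ) + 2) / n) atTop (𝓝 1) := by
    have := (tendsto_const_div_atTop_nhds_zero_nat (2 : ℝ)).const_add 1
    rw [add_zero] at this
    refine this.congr' ?_
    filter_upwards [eventually_gt_atTop 0] with n hn
    have : (n : ℝ) ≠ 0 := by positivity
    field_simp
  have h2 : Tendsto (fun n : ℕ => ((n : ℝ) + 1) / n) atTop (𝓝 1) := by
    have := (tendsto_const_div_atTop_nhds_zero_nat (1 : ℝ)).const_add 1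
    rw [add_zero] at this
    refine this.congr' ?_
    filter_upwards [eventually_gt_atTop 0] with n hn
    have : (n : ℝ) ≠ 0 := by positivity
    field_simp
  have h3 : Tendsto (fun n : ℕ => (((n : ℝ) + 2) / n) ^ (1 + p)) atTop (𝓝 1) := by
    have := h1.rpow_const (p := 1 + p) (Or.inl one_ne_zero)
    rwa [Real.one_rpow] at this
  have h4 : Tendsto (fun s : ℕ => B s * (s : ℝ) ^ p) atTop (𝓝 K) := by
    rw [← tendsto_add_atTop_iff_nat 2]
    have := (h3.mul h2).mul hJ
    rw [one_mul, one_mul] at this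
    refine this.congr' ?_
    filter_upwards [eventually_gt_atTop 0] with n hn
    have hn0 : (0 : ℝ) < n := by exact_mod_cast hn
    have hn2 : (0 : ℝ) < n + 2 := by positivity
    rw [hB, Real.div_rpow hn2.le hn0.le, Real.rpow_add_one hn0.ne' (1 + p), Real.rpow_add hn2,
      Real.rpow_one]
    have : 0 < (n : ℝ) ^ (1 + p) := Real.rpow_pos_of_pos hn0 _
    push_cast
    field_simp
  rw [isLittleO_iff_tendsto']
  · have := h4.sub_const K
    rw [sub_self] at this
    refine this.congr' ?_
    filter_upwards [eventually_gt_atTop 0] with s hs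
    have hs0 : (0 : ℝ) < s := by exact_mod_cast hs
    have : 0 < (s : ℝ) ^ p := Real.rpow_pos_of_pos hs0 _
    rw [Real.rpow_neg hs0.le]
    field_simp
  · filter_upwards [eventually_gt_atTop 0] with s hs h
    have hs0 : (0 : ℝ) < s := by exact_mod_cast hs
    exact absurd h (Real.rpow_pos_of_pos hs0 _).ne'

/-- The Watson lemma with `p = 1 + 2/d`, applied to the expectation of `μ(X) - μ x` on the event that the
ball around `x` through `X` has probability at most `v`. -/
theorem tendsto_rpow_mul_integral_withDensity (hd : 1 ≤ d)
    {f μ : EuclideanSpace ℝ (Fin d) → ℝ} {x : EuclideanSpace ℝ (Fin d)}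
    {ν : Measure (EuclideanSpace ℝ (Fin d))} [IsProbabilityMeasure ν]
    (hf : Measurable f) (hf0 : ∀ y, 0 ≤ f y)
    (hν : ν = volume.withDensity fun y => ENNReal.ofReal (f y)) (hfx : 0 < f x)
    (hfC : ContDiffAt ℝ 2 f x) (hμC : ContDiffAt ℝ 2 μ x)
    (hsphere : ∀ r, ν (Metric.sphere x r) = 0) (hμ : Integrable μ ν) :
    Tendsto (fun n : ℕ => (n : ℝ) ^ (1 + 2 / (d : ℝ) + 1) * ∫ v in (0 : ℝ)..1, (1 - v) ^ n *
      ∫ y in {y | ν.real (Metric.closedBall x ‖y - x‖) ≤ v}, (μ y - μ x) ∂ν) atTop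
      (𝓝 (biasCoeff f μ x)) := by
  have hd0 : (0 : ℝ) < d := by exact_mod_cast hd
  have hV := unitBallVol_pos d
  have hm : Integrable (fun y => μ y - μ x) ν := hμ.sub (integrable_const _)
  have hφm : Measurable fun y => ν.real (Metric.closedBall x ‖y - x‖) :=
    (monotone_measureReal_closedBall ν x).measurable.comp (by fun_prop)
  have hφ : Tendsto (fun r => ν.real (Metric.closedBall x r) / r ^ d) (𝓝[>] 0)
      (𝓝 (f x * unitBallVol d)) := by
    refine (tendsto_setIntegral_closedBall_div hd hfC).congr fun r => ?_
    have := setIntegral_withDensity_ofReal hf hf0 (fun _ => 1)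
      (Metric.isClosed_closedBall (x := x) (ε := r)).measurableSet
    rw [← hν] at this
    simp only [setIntegral_const, smul_eq_mul, mul_one, one_mul] at this
    rw [this]
  have hA := tendsto_setIntegral_closedBall_sub_mul_div hd hfC hμC
  have hA' : Tendsto (fun r => (∫ y in Metric.closedBall x r, (μ y - μ x) ∂ν) / r ^ (d + 2))
      (𝓝[>] 0) _ := hA.congr fun r => by
    rw [hν, setIntegral_withDensity_ofReal hf hf0 _ Metric.isClosed_closedBall.measurableSet]
  have hH := tendsto_setIntegral_measureReal_closedBall_le_div hd hsphere
    (mul_pos hfx hV) hφ hA'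
  rw [← gamma_mul_eq_biasCoeff hd hfx]
  refine tendsto_rpow_mul_integral_one_sub_pow_mul (M := ∫ y, |μ y - μ x| ∂ν) (by positivity)
    (intervalIntegrable_setIntegral_le hm hφm) (fun v _ => ?_) hH
  exact (abs_integral_le_integral_abs).trans
    (setIntegral_le_integral hm.abs (ae_of_all _ fun _ => abs_nonneg _))

end Bias

/-- The noise is centred and independent of `X`, so it drops out of the expectation. -/
theorem integral_response_sub_mul_comp {Ω E : Type*} [MeasurableSpace Ω] [MeasurableSpace E]
    {P : Measure Ω} [IsProbabilityMeasure P] {X : Ω → E} {Y ε : Ω → ℝ} {μ : E → ℝ}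
    (hX : Measurable X) (hμ : Measurable μ)
    (hY : ∀ ω, Y ω = μ (X ω) + ε ω) (hindep : IndepFun X ε P) (hYi : Integrable Y P)
    (hεi : Integrable ε P) (hε0 : ∫ ω, ε ω ∂P = 0) {g : E → ℝ} (hg : Measurable g)
    (hg0 : ∀ y, 0 ≤ g y) (hg1 : ∀ y, g y ≤ 1) (c : ℝ) :
    ∫ ω, (Y ω - c) * g (X ω) ∂P = ∫ y, (μ y - c) * g y ∂(P.map X) := by
  have hgX : Measurable fun ω => g (X ω) := hg.comp hX
  have hb : ∀ᵐ ω ∂P, ‖g (X ω)‖ ≤ 1 := ae_of_all _ fun ω => by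
    rw [Real.norm_eq_abs, abs_of_nonneg (hg0 _)]; exact hg1 _
  have hμX : Integrable (fun ω => μ (X ω)) P :=
    (hYi.sub hεi).congr (ae_of_all _ fun ω => by simp [hY ω])
  have hεg : ∫ ω, ε ω * g (X ω) ∂P = 0 := by
    have hi : IndepFun ε (fun ω => g (X ω)) P := hindep.symm.comp measurable_id hg
    rw [hi.integral_fun_mul_eq_mul_integral hεi.aestronglyMeasurable
      hgX.aestronglyMeasurable, hε0, zero_mul]
  have i1 : Integrable (fun ω => (μ (X ω) - c) * g (X ω)) P :=
    (hμX.sub (integrable_const c)).mul_bdd hgX.aestronglyMeasurable hb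
  have i2 : Integrable (fun ω => ε ω * g (X ω)) P := hεi.mul_bdd hgX.aestronglyMeasurable hb
  have e : ∀ ω, (Y ω - c) * g (X ω) = (μ (X ω) - c) * g (X ω) + ε ω * g (X ω) := by
    intro ω; rw [hY]; ring
  simp_rw [e]
  rw [integral_add i1 i2, hεg, add_zero, integral_map hX.aemeasurable]
  exact ((hμ.sub_const c).mul hg).aestronglyMeasurable

theorem theorem1 {d : ℕ} (hd : 1 ≤ d)
    -- the model `Y = μ(X) + ε`, with `ε` independent of `X`
    {Ω : Type*} [MeasurableSpace Ω] (P : Measure Ω) [IsProbabilityMeasure P]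
    (X : Ω → EuclideanSpace ℝ (Fin d)) (Y ε : Ω → ℝ)
    (hX : Measurable X) (hε : Measurable ε)
    (μ : EuclideanSpace ℝ (Fin d) → ℝ) (hμ : Measurable μ)
    (hY : ∀ ω, Y ω = μ (X ω) + ε ω)
    (hindep : IndepFun X ε P)
    -- moments: `E Y² < ∞`, `E ε = 0`, `0 < Var ε < ∞`
    (hY2 : MemLp Y 2 P) (hε2 : MemLp ε 2 P) (hε0 : ∫ ω, ε ω ∂P = 0)
    (hεvar : 0 < variance ε P)
    -- `X` has the Lebesgue density `f`, bounded away from `0` and `∞` almost surely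
    (f : EuclideanSpace ℝ (Fin d) → ℝ) (hf : Measurable f) (hf0 : ∀ y, 0 ≤ f y)
    (hlaw : P.map X = volume.withDensity (fun y => ENNReal.ofReal (f y)))
    (hfbdd : ∃ c C : ℝ, 0 < c ∧ ∀ᵐ y ∂(P.map X), c ≤ f y ∧ f y ≤ C)
    -- the target point and the local smoothness
    (x : EuclideanSpace ℝ (Fin d)) (hx : x ∈ (P.map X).support)
    (hfC2 : C2BoundedNear f x) (hμC2 : C2BoundedNear μ x) :
    ∃ B : ℕ → ℝ,
      -- for every i.i.d. sample of size `n` from the model and every `1 ≤ s ≤ n`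
      (∀ n s : ℕ, 1 ≤ s → s ≤ n →
        ∀ {Ω' : Type*} [MeasurableSpace Ω'] (P' : Measure Ω') [IsProbabilityMeasure P']
          (Z : Fin n → Ω' → EuclideanSpace ℝ (Fin d) × ℝ),
          iIndepFun Z P' →
          (∀ i, IdentDistrib (Z i) (fun ω => (X ω, Y ω)) P' P) →
          Integrable (fun ω => dnn s x (fun i => Z i ω)) P' ∧
          ∫ ω, dnn s x (fun i => Z i ω) ∂P' = μ x + B s) ∧
      (fun s : ℕ => B s - biasCoeff f μ x * (s : ℝ) ^ (-(2 / (d : ℝ))))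
        =o[atTop] (fun s : ℕ => (s : ℝ) ^ (-(2 / (d : ℝ)))) := by
  have : Nonempty (Fin d) := ⟨⟨0, hd⟩⟩
  have hYm : Measurable Y := by
    have : Y = fun ω => μ (X ω) + ε ω := funext hY
    rw [this]
    exact (hμ.comp hX).add hε
  have hXY : Measurable fun ω => (X ω, Y ω) := hX.prodMk hYm
  have hYi : Integrable Y P := hY2.integrable one_le_two
  have hεi : Integrable ε P := hε2.integrable one_le_two
  set ν := P.map X
  set ρ := P.map fun ω => (X ω, Y ω)
  have : IsProbabilityMeasure ν := Measure.isProbabilityMeasure_map hX.aemeasurable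
  have : IsProbabilityMeasure ρ := Measure.isProbabilityMeasure_map hXY.aemeasurable
  have hρν : ρ.map Prod.fst = ν := Measure.map_map measurable_fst hXY
  have hρ2 : Integrable Prod.snd ρ :=
    (integrable_map_measure measurable_snd.aestronglyMeasurable hXY.aemeasurable).2 hYi
  have hμν : Integrable μ ν :=
    (integrable_map_measure hμ.aestronglyMeasurable hX.aemeasurable).2
      ((hYi.sub hεi).congr (ae_of_all _ fun ω => by simp [hY ω]))
  have hsphere : ∀ r, ν (Metric.sphere x r) = 0 := fun r => by
    rw [hlaw]
    exact withDensity_absolutelyContinuous _ _ (Measure.addHaar_sphere _ x r)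
  obtain ⟨c, C, hc, hcC⟩ := hfbdd
  have hfx : 0 < f x := pos_of_mem_support hx hfC2.contDiffAt.continuousAt hc
    (hcC.mono fun y hy => hy.1)
  set φ := fun y => ν.real (Metric.closedBall x ‖y - x‖)
  have hφm : Measurable φ :=
    (monotone_measureReal_closedBall ν x).measurable.comp (by fun_prop)
  have hφ1 : ∀ y, φ y ≤ 1 := fun y => measureReal_le_one
  have hφ0 : ∀ y, 0 ≤ φ y := fun y => measureReal_nonneg
  refine ⟨fun s => ∫ z, oneNN x z ∂(Measure.pi fun _ : Fin s => ρ) - μ x, ?_, ?_⟩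
  · intro n s _ hsn Ω' _ P' _ Z hZ hZid
    rw [add_sub_cancel]
    exact integrable_dnn_and_integral_dnn hsn hρ2 hZ (fun i => (hZid i).aemeasurable_fst)
      fun i => (hZid i).map_eq
  · refine isLittleO_of_tendsto_rpow_mul (tendsto_rpow_mul_integral_withDensity hd hf hf0 hlaw hfx
      hfC2.contDiffAt hμC2.contDiffAt hsphere hμν) fun n => ?_
    rw [integral_oneNN_sub_const hρ2 (by rwa [hρν]), hρν,
      integral_map hXY.aemeasurable (by
        refine Measurable.aestronglyMeasurable ?_
        exact (measurable_snd.sub_const _).mul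
          (((hφm.comp measurable_fst).const_sub 1).pow_const _))]
    rw [integral_response_sub_mul_comp hX hμ hY hindep hYi hεi hε0
      (g := fun y => (1 - φ y) ^ (n + 1)) ((hφm.const_sub 1).pow_const _)
      (fun y => pow_nonneg (sub_nonneg.2 (hφ1 y)) _)
      (fun y => pow_le_one₀ (sub_nonneg.2 (hφ1 y)) (sub_le_self 1 (hφ0 y))) (μ x),
      integral_mul_one_sub_pow_eq (m := fun y => μ y - μ x)
        (hμν.sub (integrable_const (μ x))) hφm hφ0 hφ1 n]
    push_cast
    ring
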